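/- Let $(\mathcal M,g,A)$ be a Kähler manifold of real dimension $n=2k\ge 4$: $(\mathcal M,g)$ is a smooth Riemannian manifold with Levi-Civita connection $\nabla$, and $A$ is a smooth $(1,1)$ tensor field with $A^2=-I$, $g(AX,AY)=g(X,Y)$ and $\nabla A=0$. Let $\pi$ be a smooth 1-form, let $$\overset{1}{\nabla}_XY=\nabla_XY-\pi(X)AY$$ be the quarter-symmetric metric $A$-connection generated by $\pi$, and let $\overset{2}{\nabla}_XY=\overset{1}{\nabla}_YX+[X,Y]$ be its dual connection. Let $R,\overset{1}{R},\overset{2}{R}$ be the curvature tensors of $\nabla,\overset{1}{\nabla},\overset{2}{\nabla}$, where the curvature tensor of a connection $D$ is $(X,Y)Z\mapsto D_XD_YZ-D_YD_XZ-D_{[X,Y]}Z$, and let $Ric,\overset{1}{R}ic,\overset{2}{R}ic$ be the corresponding Ricci tensors, with $Ric(Y,Z)=\mathrm{Trace}\{X\mapsto R(X,Y)Z\}$ and likewise for the others. Put $$\overset{1}{H}(X,Y)Z=\overset{1}{R}(X,Y)Z+\overset{1}{R}ic(Y,AX)AZ,$$ $$\overset{2}{H}(X,Y)Z=\overset{2}{R}(X,Y)Z+\overset{2}{R}ic(AX,Z)AY-\overset{2}{R}ic(AY,Z)AX,$$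 and let $$W(X,Y)Z=R(X,Y)Z+\tfrac1{n-1}\bigl(Ric(X,Z)Y-Ric(Y,Z)X\bigr),$$ $$P(X,Y)Z=R(X,Y)Z+\tfrac1{n+2}\bigl(Ric(X,Z)Y-Ric(Y,Z)X\bigr)-\tfrac1{n+2}\bigl(Ric(X,AZ)AY-Ric(Y,AZ)AX+2Ric(X,AY)AZ\bigr)$$ be the Weyl projective and the holomorphically projective curvature tensors. Then $$2\overset{1}{H}(X,Y)Z+\overset{2}{H}(X,Y)Z=(n+2)P(X,Y)Z-(n-1)W(X,Y)Z .$$ Consequently, if $\overset{1}{H}$ and $\overset{2}{H}$ both vanish on $\mathcal M$, then $$P(X,Y)Z=\frac{n-1}{n+2}\,W(X,Y)Z .$$ -/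

import Mathlib

open Bundle Manifold
open scoped ContDiff

noncomputable section

namespace KahlerQS

/-- Trace of an endomorphism of a finite-dimensional real vector space, given as a bare function:
the sum of its diagonal coefficients in a basis. -/
def endTrace {V : Type*} [AddCommGroup V] [Module ℝ V] [FiniteDimensional ℝ V] (f : V → V) : ℝ :=
  ∑ i, (Module.finBasis ℝ V).repr (f (Module.finBasis ℝ V i)) i

/-- On linear maps `endTrace` is the usual trace. -/
theorem endTrace_linearMap {V : Type*} [AddCommGroup V] [Module ℝ V] [FiniteDimensional ℝ V]
    (L : V →ₗ[ℝ] V) : endTrace L = LinearMap.trace ℝ V L := by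
  rw [LinearMap.trace_eq_matrix_trace ℝ (Module.finBasis ℝ V)]
  simp [endTrace, Matrix.trace, LinearMap.toMatrix_apply]

section Connections

variable {n : ℕ} {M : Type*} [TopologicalSpace M] [ChartedSpace (EuclideanSpace ℝ (Fin n)) M]

instance finiteDimensional_tangentSpace (x : M) :
    FiniteDimensional ℝ (TangentSpace (𝓡 n) x) :=
  inferInstanceAs (FiniteDimensional ℝ (EuclideanSpace ℝ (Fin n)))

/-- Linear connections on (the tangent bundle of) an `n`-manifold.
For `D` of this type, `D Y x v` is `(∇_v Y)(x)`. -/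
abbrev LinearConnection (n : ℕ) (M : Type*) [TopologicalSpace M]
    [ChartedSpace (EuclideanSpace ℝ (Fin n)) M] [IsManifold (𝓡 n) ∞ M] :=
  CovariantDerivative (𝓡 n) (EuclideanSpace ℝ (Fin n)) (fun x : M ↦ TangentSpace (𝓡 n) x)

variable [IsManifold (𝓡 n) ∞ M]

/-- The vector field `∇_X ∇_Y Z - ∇_Y ∇_X Z - ∇_{[X,Y]} Z`. -/
def curvatureField (D : LinearConnection n M) (X Y Z : Π x : M, TangentSpace (𝓡 n) x) :
    Π x : M, TangentSpace (𝓡 n) x :=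
  fun x ↦ D (fun y ↦ D Z y (Y y)) x (X x) - D (fun y ↦ D Z y (X y)) x (Y x)
    - D Z x (VectorField.mlieBracket (𝓡 n) X Y x)

/-- The curvature tensor `R(u,v)w` on tangent vectors at `x`, computed by extending `u, v, w` to
vector fields that are smooth near `x`. -/
def curvature (D : LinearConnection n M) (x : M) (u v w : TangentSpace (𝓡 n) x) :
    TangentSpace (𝓡 n) x :=
  curvatureField D (FiberBundle.extend (EuclideanSpace ℝ (Fin n)) u)
    (FiberBundle.extend (EuclideanSpace ℝ (Fin n)) v)
    (FiberBundle.extend (EuclideanSpace ℝ (Fin n)) w) x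

/-- The Ricci tensor `Ric(v,w) = Trace {u ↦ R(u,v)w}`. -/
def ricci (D : LinearConnection n M) (x : M) (v w : TangentSpace (𝓡 n) x) : ℝ :=
  endTrace fun u ↦ curvature D x u v w

/-- The connection `∇²` dual to `∇¹`: `∇²_X Y = ∇¹_Y X + [X,Y]`, in other words
`∇²_X Y = ∇¹_X Y + T(Y,X)` with `T` the torsion of `∇¹`. -/
def dualConnection (D : LinearConnection n M) : LinearConnection n M :=
  D.addOneForm D.torsion

theorem dualConnection_apply (D : LinearConnection n M) {X Y : Π x : M, TangentSpace (𝓡 n) x}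
    {x : M}
    (hX : MDifferentiableAt (𝓡 n) (𝓡 n).tangent
      (fun y ↦ (⟨y, X y⟩ : TangentBundle (𝓡 n) M)) x)
    (hY : MDifferentiableAt (𝓡 n) (𝓡 n).tangent
      (fun y ↦ (⟨y, Y y⟩ : TangentBundle (𝓡 n) M)) x) :
    dualConnection D Y x (X x) = D X x (Y x) + VectorField.mlieBracket (𝓡 n) X Y x := by
  have h := D.torsion_apply hY hX
  change D Y x (X x) + D.torsion x (Y x) (X x) = _
  rw [h, VectorField.mlieBracket_swap]
  simp only [Pi.neg_apply]
  module

/-- The quarter-symmetric connection `∇¹_X Y = ∇_X Y - π(X) A Y` generated by the 1-form `π`. -/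
def quarterSymmetric (D : LinearConnection n M)
    (A : Π x : M, TangentSpace (𝓡 n) x →L[ℝ] TangentSpace (𝓡 n) x)
    (p : Π x : M, TangentSpace (𝓡 n) x →L[ℝ] ℝ) : LinearConnection n M where
  toFun Y x := D Y x - (p x).smulRight (A x (Y x))
  isCovariantDerivativeOnUniv :=
    { add := fun hY hY' _ ↦ by
        rw [D.isCovariantDerivativeOnUniv.add hY hY']
        ext v
        simp
        abel
      leibniz := fun hY hf _ ↦ by
        rw [D.isCovariantDerivativeOnUniv.leibniz hY hf]
        ext v
        simp
        module }

/-- The tensor `H¹(X,Y)Z = R¹(X,Y)Z + Ric¹(Y,AX)AZ`, where `R¹`, `Ric¹` are the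
curvature and Ricci tensors of the connection `D` (which plays the role of `∇¹`). -/
def tensorH1 (D : LinearConnection n M)
    (A : Π x : M, TangentSpace (𝓡 n) x →L[ℝ] TangentSpace (𝓡 n) x)
    (x : M) (u v w : TangentSpace (𝓡 n) x) : TangentSpace (𝓡 n) x :=
  curvature D x u v w + ricci D x v (A x u) • A x w

/-- The tensor `H²(X,Y)Z = R²(X,Y)Z + Ric²(AX,Z)AY - Ric²(AY,Z)AX`, where `R²`, `Ric²` are the
curvature and Ricci tensors of the connection dual to `D` (which plays the role of `∇¹`). -/
def tensorH2 (D : LinearConnection n M)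
    (A : Π x : M, TangentSpace (𝓡 n) x →L[ℝ] TangentSpace (𝓡 n) x)
    (x : M) (u v w : TangentSpace (𝓡 n) x) : TangentSpace (𝓡 n) x :=
  curvature (dualConnection D) x u v w + ricci (dualConnection D) x (A x u) w • A x v
    - ricci (dualConnection D) x (A x v) w • A x u

/-- The Weyl projective curvature tensor. -/
def weylProjective (D : LinearConnection n M) (x : M) (u v w : TangentSpace (𝓡 n) x) :
    TangentSpace (𝓡 n) x :=
  curvature D x u v w + (1 / ((n : ℝ) - 1)) • (ricci D x u w • v - ricci D x v w • u)

/-- The holomorphically projective curvature tensor. -/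
def holProjective (D : LinearConnection n M)
    (A : Π x : M, TangentSpace (𝓡 n) x →L[ℝ] TangentSpace (𝓡 n) x)
    (x : M) (u v w : TangentSpace (𝓡 n) x) : TangentSpace (𝓡 n) x :=
  curvature D x u v w + (1 / ((n : ℝ) + 2)) • (ricci D x u w • v - ricci D x v w • u)
    - (1 / ((n : ℝ) + 2)) • (ricci D x u (A x w) • A x v - ricci D x v (A x w) • A x u
      + (2 * ricci D x u (A x v)) • A x w)

end Connections

section Kahler

variable {n : ℕ} {M : Type*} [TopologicalSpace M] [ChartedSpace (EuclideanSpace ℝ (Fin n)) M]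
  [IsManifold (𝓡 n) ∞ M] [RiemannianBundle (fun x : M ↦ TangentSpace (𝓡 n) x)]
  [IsContMDiffRiemannianBundle (𝓡 n) ∞ (EuclideanSpace ℝ (Fin n))
    (fun x : M ↦ TangentSpace (𝓡 n) x)]

instance isContMDiffRiemannianBundle_one :
    IsContMDiffRiemannianBundle (𝓡 n) 1 (EuclideanSpace ℝ (Fin n))
      (fun x : M ↦ TangentSpace (𝓡 n) x) :=
  IsContMDiffRiemannianBundle.of_le (n := ∞) (by simp)

/-- `D` is the Levi-Civita connection of the Riemannian metric of `M`: a smooth linear connection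
that is torsion-free and preserves the metric. -/
structure IsLeviCivita (D : LinearConnection n M) : Prop where
  smooth : D.ContMDiffCovariantDerivative ∞
  torsion_eq_zero : D.torsion = 0
  metric : D.IsMetricCompatible

/-- `A` is a smooth (1,1) tensor field making the Riemannian manifold `M` almost Hermitian:
`A² = -I` and `g(AX,AY) = g(X,Y)`. -/
structure IsAlmostHermitian
    (A : Π x : M, TangentSpace (𝓡 n) x →L[ℝ] TangentSpace (𝓡 n) x) : Prop where
  smooth : ContMDiff (𝓡 n)
    ((𝓡 n).prod 𝓘(ℝ, EuclideanSpace ℝ (Fin n) →L[ℝ] EuclideanSpace ℝ (Fin n))) ∞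
    (fun x ↦ TotalSpace.mk' (EuclideanSpace ℝ (Fin n) →L[ℝ] EuclideanSpace ℝ (Fin n))
      (E := fun x : M ↦ TangentSpace (𝓡 n) x →L[ℝ] TangentSpace (𝓡 n) x) x (A x))
  sq (x : M) (u : TangentSpace (𝓡 n) x) : A x (A x u) = -u
  inner_map (x : M) (u v : TangentSpace (𝓡 n) x) : inner ℝ (A x u) (A x v) = inner ℝ u v

/-- `(M, g, A)`, with Levi-Civita connection `D`, is a Kähler manifold: it is almost Hermitian and
`∇A = 0`, that is `∇_X (A Y) = A (∇_X Y)`. -/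
structure IsKahler (D : LinearConnection n M)
    (A : Π x : M, TangentSpace (𝓡 n) x →L[ℝ] TangentSpace (𝓡 n) x) : Prop
    extends IsAlmostHermitian A where
  parallel (Y : Π x : M, TangentSpace (𝓡 n) x) (x : M)
    (hY : MDifferentiableAt (𝓡 n) (𝓡 n).tangent
      (fun y ↦ (⟨y, Y y⟩ : TangentBundle (𝓡 n) M)) x) (v : TangentSpace (𝓡 n) x) :
    D (fun y ↦ A y (Y y)) x v = A x (D Y x v)

/-- The 1-form `p` is smooth. -/
def IsSmoothOneForm (p : Π x : M, TangentSpace (𝓡 n) x →L[ℝ] ℝ) : Prop :=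
  ContMDiff (𝓡 n) ((𝓡 n).prod 𝓘(ℝ, EuclideanSpace ℝ (Fin n) →L[ℝ] ℝ)) ∞
    (fun x ↦ TotalSpace.mk' (EuclideanSpace ℝ (Fin n) →L[ℝ] ℝ)
      (E := fun x : M ↦ TangentSpace (𝓡 n) x →L[ℝ] ℝ) x (p x))

end Kahler

end KahlerQS

end

/-! The tensors $\overset{1}{H}$ and $\overset{2}{H}$ are built so that $\pi$ drops out. Write
$\theta_w(u)=(\nabla_u\pi)(w)+\pi(w)\pi(Au)$. Since $\nabla A=0$, $A^2=-I$ and $\nabla$ is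
torsion-free, $\overset{1}{R}(u,v)w=R(u,v)w-d\pi(u,v)Aw$ and
$\overset{2}{R}(u,v)w=R(u,v)w-\theta_w(u)Av+\theta_w(v)Au$. Traces over $u$, with
$\mathrm{tr}\,A=0$, give $\overset{1}{R}ic(v,w)=Ric(v,w)-d\pi(Aw,v)$ and
$\overset{2}{R}ic(v,w)=Ric(v,w)-\theta_w(Av)$. One more $A$ in the Ricci arguments turns $A^2$ into
$-1$, and the corrections cancel those of the curvature (`tensorH1_eq`, `tensorH2_eq`).

What is left is an identity for $\nabla$ alone. In $(n+2)P-(n-1)W$ the curvature has coefficient $3$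
and the Ricci terms without $A$ cancel; the others match because $Ric$ is symmetric and
$A$-invariant (`ricci_symm`, `ricci_map_map`). These two facts follow from the algebraic symmetries
of a Kähler curvature tensor, which are derived from the connection by computing with commuting
local coordinate fields. -/

noncomputable section

open Filter Topology

namespace KahlerQS

/-! ### Coordinate extensions of tangent vectors: vanishing brackets, commuting derivatives. -/

section


variable {n : ℕ} {M : Type*} [TopologicalSpace M] [ChartedSpace (EuclideanSpace ℝ (Fin n)) M]
  [IsManifold (𝓡 n) ∞ M]

/-- A globally smooth vector field. -/
def IsSmoothField (X : Π x : M, TangentSpace (𝓡 n) x) : Prop :=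
  ContMDiff (𝓡 n) (𝓡 n).tangent ∞ (fun y ↦ (⟨y, X y⟩ : TangentBundle (𝓡 n) M))

theorem IsSmoothField.mdifferentiableAt {X : Π x : M, TangentSpace (𝓡 n) x}
    (hX : IsSmoothField X) (x : M) :
    MDifferentiableAt (𝓡 n) (𝓡 n).tangent
      (fun y ↦ (⟨y, X y⟩ : TangentBundle (𝓡 n) M)) x :=
  (hX x).mdifferentiableAt (by simp)

theorem IsSmoothField.sub {X Y : Π x : M, TangentSpace (𝓡 n) x} (hX : IsSmoothField X)
    (hY : IsSmoothField Y) : IsSmoothField (X - Y) :=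
  ContMDiff.sub_section hX hY

theorem IsSmoothField.smul {f : M → ℝ} {X : Π x : M, TangentSpace (𝓡 n) x}
    (hf : ContMDiff (𝓡 n) 𝓘(ℝ, ℝ) ∞ f) (hX : IsSmoothField X) : IsSmoothField (f • X) :=
  ContMDiff.smul_section hf hX

/-- The coordinates at `y` of a tangent vector, in the preferred chart at `x`. -/
def coord (x y : M) : TangentSpace (𝓡 n) y →L[ℝ] EuclideanSpace ℝ (Fin n) :=
  (trivializationAt (EuclideanSpace ℝ (Fin n)) (TangentSpace (𝓡 n)) x).continuousLinearMapAt ℝ y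

/-- The extension of a tangent vector at `x` to a vector field that is constant in the preferred
chart near `x`, cut off so as to be globally smooth. -/
def extendField {x : M} (u : TangentSpace (𝓡 n) x) (y : M) : TangentSpace (𝓡 n) y :=
  (Classical.arbitrary (SmoothBumpFunction (𝓡 n) x)) y •
    (trivializationAt (EuclideanSpace ℝ (Fin n)) (TangentSpace (𝓡 n)) x).symmL ℝ y (coord x x u)

theorem extend_eq_symmL {x : M} (u : TangentSpace (𝓡 n) x) {y : M}
    (hy : y ∈ (chartAt (EuclideanSpace ℝ (Fin n)) x).source) :
    FiberBundle.extend (EuclideanSpace ℝ (Fin n)) u y =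
      (trivializationAt (EuclideanSpace ℝ (Fin n)) (TangentSpace (𝓡 n)) x).symmL ℝ y
        (coord x x u) := by
  rw [Trivialization.symmL_apply _ (by simpa using hy)]
  unfold FiberBundle.extend coord
  rw [Trivialization.continuousLinearMapAt_apply_of_mem]
  simp

theorem contMDiffOn_symmL {x : M} (a : EuclideanSpace ℝ (Fin n)) :
    ContMDiffOn (𝓡 n) (𝓡 n).tangent ∞
      (fun y ↦ (⟨y, (trivializationAt (EuclideanSpace ℝ (Fin n)) (TangentSpace (𝓡 n)) x).symmL ℝ y
        a⟩ : TangentBundle (𝓡 n) M))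
      (chartAt (EuclideanSpace ℝ (Fin n)) x).source := by
  have h := (trivializationAt (EuclideanSpace ℝ (Fin n)) (TangentSpace (𝓡 n))
    x).contMDiffOn_section_baseSet_iff (IB := 𝓡 n) (n := ∞)
    (s := fun y : M ↦
      (trivializationAt (EuclideanSpace ℝ (Fin n)) (TangentSpace (𝓡 n)) x).symmL ℝ y a)
  rw [TangentBundle.trivializationAt_baseSet] at h
  refine h.2 ((contMDiffOn_const (c := a)).congr fun y hy ↦ ?_)
  have hy' : y ∈ (trivializationAt (EuclideanSpace ℝ (Fin n)) (TangentSpace (𝓡 n)) x).baseSet := by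
    simpa using hy
  rw [← Trivialization.continuousLinearMapAt_apply_of_mem (R := ℝ) _ hy',
    Trivialization.continuousLinearMapAt_symmL _ hy']

theorem extendField_eventuallyEq {x : M} (u : TangentSpace (𝓡 n) x) : ∀ᶠ y in 𝓝 x,
    extendField u y = FiberBundle.extend (EuclideanSpace ℝ (Fin n)) u y := by
  have hs := (chartAt (EuclideanSpace ℝ (Fin n)) x).open_source
  filter_upwards [hs.mem_nhds (mem_chart_source _ x),
    (Classical.arbitrary (SmoothBumpFunction (𝓡 n) x)).eventuallyEq_one] with y hs hy
  simp [extendField, hy, extend_eq_symmL u hs]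

@[simp]
theorem extendField_self {x : M} (u : TangentSpace (𝓡 n) x) : extendField u x = u := by
  rw [(extendField_eventuallyEq u).self_of_nhds, FiberBundle.extend_apply_self]

theorem extendField_add {x : M} (u v : TangentSpace (𝓡 n) x) :
    extendField (u + v) = extendField u + extendField v := by
  ext1 y
  simp [extendField]

theorem extendField_smul {x : M} (c : ℝ) (u : TangentSpace (𝓡 n) x) :
    extendField (c • u) = c • extendField u := by
  ext1 y
  simp [extendField, smul_comm c]

theorem isSmoothField_extendField [T2Space M] {x : M} (u : TangentSpace (𝓡 n) x) :
    IsSmoothField (extendField u) :=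
  ContMDiffOn.smul_section_of_tsupport
    (Classical.arbitrary (SmoothBumpFunction (𝓡 n) x)).contMDiff.contMDiffOn
    (chartAt (EuclideanSpace ℝ (Fin n)) x).open_source
    (Classical.arbitrary (SmoothBumpFunction (𝓡 n) x)).tsupport_subset_chartAt_source
    (contMDiffOn_symmL _)

/-- `extendField u` is a coordinate field with constant coefficients. -/
theorem coord_extendField {x : M} (u : TangentSpace (𝓡 n) x) : ∀ᶠ y in 𝓝 x,
    coord x y (extendField u y) = coord x x u := by
  have hs := (chartAt (EuclideanSpace ℝ (Fin n)) x).open_source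
  filter_upwards [hs.mem_nhds (mem_chart_source _ x), extendField_eventuallyEq u] with y hy hu
  rw [hu, extend_eq_symmL u hy]
  exact Trivialization.continuousLinearMapAt_symmL _ (by simpa using hy) _

theorem mfderiv_extChartAt_extendField {x : M} (u : TangentSpace (𝓡 n) x) : ∀ᶠ y in 𝓝 x,
    mfderiv (𝓡 n) 𝓘(ℝ, EuclideanSpace ℝ (Fin n)) (extChartAt (𝓡 n) x) y (extendField u y) =
      coord x x u := by
  have hs := (chartAt (EuclideanSpace ℝ (Fin n)) x).open_source
  filter_upwards [hs.mem_nhds (mem_chart_source _ x), coord_extendField u] with y hy hu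
  have h := TangentBundle.continuousLinearMapAt_trivializationAt (I := 𝓡 n) hy
  exact (DFunLike.congr_fun h _).symm.trans hu

theorem mlieBracket_const (a b z : EuclideanSpace ℝ (Fin n)) :
    VectorField.mlieBracket 𝓘(ℝ, EuclideanSpace ℝ (Fin n)) (fun _ ↦ a) (fun _ ↦ b) z = 0 := by
  have h := congrFun (VectorField.mlieBracketWithin_eq_lieBracketWithin (𝕜 := ℝ)
    (E := EuclideanSpace ℝ (Fin n)) (V := fun _ ↦ a) (W := fun _ ↦ b) (s := Set.univ)) z
  have h' : VectorField.lieBracketWithin ℝ (fun _ : EuclideanSpace ℝ (Fin n) ↦ a) (fun _ ↦ b)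
      Set.univ z = 0 := by
    simp [VectorField.lieBracketWithin]
  exact h.trans h'

/-- Near `x` both fields are pullbacks of constant fields under the chart, and pullback commutes
with the bracket. -/
theorem mlieBracket_extendField {x : M} (u v : TangentSpace (𝓡 n) x) : ∀ᶠ y in 𝓝 x,
    VectorField.mlieBracket (𝓡 n) (extendField u) (extendField v) y = 0 := by
  have key (w : TangentSpace (𝓡 n) x) : ∀ᶠ y in 𝓝 x, extendField w y =
      VectorField.mpullback (𝓡 n) 𝓘(ℝ, EuclideanSpace ℝ (Fin n)) (extChartAt (𝓡 n) x)
        (fun _ ↦ coord x x w) y := by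
    have hs := (isOpen_extChartAt_source (I := 𝓡 n) x)
    filter_upwards [hs.mem_nhds (mem_extChartAt_source x), mfderiv_extChartAt_extendField w]
      with y hy hw
    have hi := isInvertible_mfderiv_extChartAt (I := 𝓡 n) hy
    exact (hi.inverse_apply_eq.2 hw.symm).symm
  have hs := (chartAt (EuclideanSpace ℝ (Fin n)) x).open_source
  have : IsManifold (𝓡 n) (minSmoothness ℝ 2) M := by
    rw [minSmoothness_of_isRCLikeNormedField]; infer_instance
  have hc (a : EuclideanSpace ℝ (Fin n)) (z : EuclideanSpace ℝ (Fin n)) :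
      MDifferentiableAt (𝓡 n) (𝓡 n).tangent
        (fun y ↦ (⟨y, a⟩ : TangentBundle (𝓡 n) (EuclideanSpace ℝ (Fin n)))) z :=
    (contMDiffAt_vectorSpace_iff_contDiffAt (n := 1).2 contDiffAt_const).mdifferentiableAt
      (by simp)
  filter_upwards [(key u).eventually_nhds, (key v).eventually_nhds,
    hs.mem_nhds (mem_chart_source _ x)] with y hu hv hy
  rw [Filter.EventuallyEq.mlieBracket_vectorField_eq hu hv]
  have := VectorField.mpullback_mlieBracket (I := 𝓡 n) (I' := 𝓘(ℝ, EuclideanSpace ℝ (Fin n)))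
    (n := 2) (x₀ := y) (f := extChartAt (𝓡 n) x)
    (V := fun _ ↦ coord x x u) (W := fun _ ↦ coord x x v)
    (hc _ _) (hc _ _) (contMDiffAt_extChartAt' hy) (by simp)
  refine this.symm.trans ?_
  have h0 := mlieBracket_const (coord x x u) (coord x x v) (extChartAt (𝓡 n) x y)
  exact (congrArg (mfderiv (𝓡 n) 𝓘(ℝ, EuclideanSpace ℝ (Fin n)) (extChartAt (𝓡 n) x) y).inverse
    h0).trans (map_zero _)

theorem contDiffOn_comp_extChartAt_symm {f : M → ℝ} (hf : ContMDiff (𝓡 n) 𝓘(ℝ, ℝ) ∞ f) (x : M) :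
    ContDiffOn ℝ ∞ (f ∘ (extChartAt (𝓡 n) x).symm) (extChartAt (𝓡 n) x).target :=
  (hf.comp_contMDiffOn (contMDiffOn_extChartAt_symm x)).contDiffOn

theorem mvfderiv_extendField {f : M → ℝ} (hf : ContMDiff (𝓡 n) 𝓘(ℝ, ℝ) ∞ f) {x : M}
    (u : TangentSpace (𝓡 n) x) : ∀ᶠ y in 𝓝 x,
    mvfderiv (𝓡 n) f y (extendField u y) =
      fderiv ℝ (f ∘ (extChartAt (𝓡 n) x).symm) (extChartAt (𝓡 n) x y) (coord x x u) := by
  have hs := (isOpen_extChartAt_source (I := 𝓡 n) x)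
  filter_upwards [hs.mem_nhds (mem_extChartAt_source x), mfderiv_extChartAt_extendField u]
    with y hy hu
  set φ := extChartAt (𝓡 n) x
  have hφ : MDifferentiableAt (𝓡 n) 𝓘(ℝ, EuclideanSpace ℝ (Fin n)) φ y :=
    mdifferentiableAt_extChartAt (by simpa [φ] using hy)
  have hg : MDifferentiableAt 𝓘(ℝ, EuclideanSpace ℝ (Fin n)) 𝓘(ℝ, ℝ) (f ∘ φ.symm) (φ y) :=
    (((contDiffOn_comp_extChartAt_symm hf x).contDiffAt
      ((isOpen_extChartAt_target (I := 𝓡 n) x).mem_nhds (φ.map_source hy))).differentiableAt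
      (by simp)).mdifferentiableAt
  have heq : f =ᶠ[𝓝 y] (f ∘ φ.symm) ∘ φ := by
    filter_upwards [hs.mem_nhds hy] with z hz
    simp [φ.left_inv hz]
  have h1 : mfderiv (𝓡 n) 𝓘(ℝ, ℝ) f y = mfderiv (𝓡 n) 𝓘(ℝ, ℝ) ((f ∘ φ.symm) ∘ φ) y :=
    heq.mfderiv_eq
  rw [mfderiv_comp y hg hφ, mfderiv_eq_fderiv] at h1
  have h2 := DFunLike.congr_fun h1 (extendField u y)
  exact h2.trans (congrArg (fderiv ℝ (f ∘ φ.symm) (φ y)) hu)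

/-- In the chart both sides are the second derivative of `f` on two constant vectors, which is
symmetric. -/
theorem mvfderiv_mvfderiv_comm {f : M → ℝ} (hf : ContMDiff (𝓡 n) 𝓘(ℝ, ℝ) ∞ f) {x : M}
    (u v : TangentSpace (𝓡 n) x) :
    mvfderiv (𝓡 n) (fun y ↦ mvfderiv (𝓡 n) f y (extendField v y)) x u =
      mvfderiv (𝓡 n) (fun y ↦ mvfderiv (𝓡 n) f y (extendField u y)) x v := by
  set φ := extChartAt (𝓡 n) x
  have hsm : ContDiffAt ℝ ∞ (f ∘ φ.symm) (φ x) :=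
    (contDiffOn_comp_extChartAt_symm hf x).contDiffAt
      ((isOpen_extChartAt_target (I := 𝓡 n) x).mem_nhds (φ.map_source (mem_extChartAt_source x)))
  have key (u v : TangentSpace (𝓡 n) x) :
      mvfderiv (𝓡 n) (fun y ↦ mvfderiv (𝓡 n) f y (extendField v y)) x u =
        fderiv ℝ (fderiv ℝ (f ∘ φ.symm)) (φ x) (coord x x u) (coord x x v) := by
    have hφ : MDifferentiableAt (𝓡 n) 𝓘(ℝ, EuclideanSpace ℝ (Fin n)) φ x :=
      mdifferentiableAt_extChartAt (by simp)
    have hd : DifferentiableAt ℝ (fderiv ℝ (f ∘ φ.symm)) (φ x) :=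
      (hsm.fderiv_right (m := 1) (by rw [one_add_one_eq_two]; exact WithTop.coe_le_coe.2 le_top)).differentiableAt (by simp)
    have hd' := hd.clm_apply (differentiableAt_const (coord x x v))
    have h1 : mfderiv (𝓡 n) 𝓘(ℝ, ℝ) (fun y ↦ mvfderiv (𝓡 n) f y (extendField v y)) x =
        mfderiv (𝓡 n) 𝓘(ℝ, ℝ) ((fun z ↦ fderiv ℝ (f ∘ φ.symm) z (coord x x v)) ∘ φ) x :=
      EventuallyEq.mfderiv_eq (mvfderiv_extendField hf v)
    rw [mfderiv_comp x hd'.mdifferentiableAt hφ, mfderiv_eq_fderiv] at h1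
    have h2 := DFunLike.congr_fun h1 u
    have hu := (mfderiv_extChartAt_extendField u).self_of_nhds
    rw [extendField_self] at hu
    refine h2.trans ((congrArg (fderiv ℝ (fun z ↦ fderiv ℝ (f ∘ φ.symm) z (coord x x v)) (φ x))
      hu).trans ?_)
    rw [fderiv_clm_apply hd (differentiableAt_const _)]
    simp
  rw [key, key]
  exact (hsm.isSymmSndFDerivAt (by simpa using WithTop.coe_le_coe.2 (le_top : (2 : ℕ∞) ≤ ⊤))).eq _ _

end

/-! ### Curvature of a connection through coordinate fields; first Bianchi identity. -/

section


variable {n : ℕ} {M : Type*} [TopologicalSpace M] [ChartedSpace (EuclideanSpace ℝ (Fin n)) M]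
  [IsManifold (𝓡 n) ∞ M]

/-- The covariant derivative of a smooth field along a smooth field is smooth. -/
def PreservesSmooth (D : LinearConnection n M) : Prop :=
  ∀ ⦃Y Z : Π x : M, TangentSpace (𝓡 n) x⦄, IsSmoothField Y → IsSmoothField Z →
    IsSmoothField fun y ↦ D Z y (Y y)

section Connection

variable {D : LinearConnection n M} {X Y : Π x : M, TangentSpace (𝓡 n) x} {x : M}

theorem connection_add (hX : IsSmoothField X) (hY : IsSmoothField Y) :
    D (X + Y) x = D X x + D Y x :=
  D.isCovariantDerivativeOnUniv.add (hX.mdifferentiableAt x) (hY.mdifferentiableAt x)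

theorem connection_const_smul (c : ℝ) (hX : IsSmoothField X) : D (c • X) x = c • D X x :=
  D.isCovariantDerivativeOnUniv.smul_const c (hX.mdifferentiableAt x)

theorem connection_sub (hX : IsSmoothField X) (hY : IsSmoothField Y) :
    D (X - Y) x = D X x - D Y x := by
  have h := connection_add (D := D) (x := x) (hX.sub hY) hY
  rw [sub_add_cancel] at h
  rw [h, add_sub_cancel_right]

theorem connection_smul {f : M → ℝ} (hf : ContMDiff (𝓡 n) 𝓘(ℝ, ℝ) ∞ f) (hX : IsSmoothField X)
    (u : TangentSpace (𝓡 n) x) :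
    D (f • X) x u = f x • D X x u + mvfderiv (𝓡 n) f x u • X x := by
  rw [D.isCovariantDerivativeOnUniv.leibniz (hX.mdifferentiableAt x)
    (hf.mdifferentiableAt (by simp))]
  simp

theorem connection_congr (hX : IsSmoothField X) (h : ∀ᶠ y in 𝓝 x, X y = Y y) :
    D X x = D Y x := by
  refine D.isCovariantDerivativeOnUniv.congr_of_eventuallyEq (hX.mdifferentiableAt x) ?_
    Filter.univ_mem h
  refine (hX.mdifferentiableAt x).congr_of_eventuallyEq ?_
  filter_upwards [h] with y hy
  rw [hy]

variable [T2Space M]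

/-- The bracket term vanishes for coordinate fields. Since a connection is local, the extensions in
`curvature` may be replaced by globally smooth ones that agree with them near `x`. -/
theorem curvature_eq (hD : PreservesSmooth D) (u v w : TangentSpace (𝓡 n) x) :
    curvature D x u v w = D (fun y ↦ D (extendField w) y (extendField v y)) x u
      - D (fun y ↦ D (extendField w) y (extendField u y)) x v := by
  have hs {a : TangentSpace (𝓡 n) x} := isSmoothField_extendField a
  have key (a : TangentSpace (𝓡 n) x) :
      D (fun y ↦ D (FiberBundle.extend (EuclideanSpace ℝ (Fin n)) w) y
        (FiberBundle.extend (EuclideanSpace ℝ (Fin n)) a y)) x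
      = D (fun y ↦ D (extendField w) y (extendField a y)) x := by
    symm
    refine connection_congr (hD hs hs) ?_
    filter_upwards [(extendField_eventuallyEq w).eventually_nhds, extendField_eventuallyEq a]
      with y hw ha
    rw [connection_congr hs hw, ha]
  have hb : VectorField.mlieBracket (𝓡 n) (FiberBundle.extend (EuclideanSpace ℝ (Fin n)) u)
      (FiberBundle.extend (EuclideanSpace ℝ (Fin n)) v) x = 0 := by
    rw [← (mlieBracket_extendField u v).self_of_nhds]
    symm
    exact Filter.EventuallyEq.mlieBracket_vectorField_eq (extendField_eventuallyEq u)
      (extendField_eventuallyEq v)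
  simp only [curvature, curvatureField, hb, key u, key v, FiberBundle.extend_apply_self]
  simp

theorem curvature_swap (hD : PreservesSmooth D) (u v w : TangentSpace (𝓡 n) x) :
    curvature D x u v w = -curvature D x v u w := by
  rw [curvature_eq hD, curvature_eq hD, neg_sub]

/-- No tensoriality is needed: `extendField` is itself additive in the vector. -/
theorem curvature_add_left (hD : PreservesSmooth D) (u u' v w : TangentSpace (𝓡 n) x) :
    curvature D x (u + u') v w = curvature D x u v w + curvature D x u' v w := by
  have hs {a : TangentSpace (𝓡 n) x} := isSmoothField_extendField a
  have h : (fun y ↦ D (extendField w) y (extendField (u + u') y)) =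
      (fun y ↦ D (extendField w) y (extendField u y)) +
        fun y ↦ D (extendField w) y (extendField u' y) := by
    ext1 y
    simp [extendField_add]
  simp only [curvature_eq hD, h, connection_add (hD hs hs) (hD hs hs), map_add,
    add_apply]
  abel

theorem curvature_smul_left (hD : PreservesSmooth D) (c : ℝ) (u v w : TangentSpace (𝓡 n) x) :
    curvature D x (c • u) v w = c • curvature D x u v w := by
  have hs {a : TangentSpace (𝓡 n) x} := isSmoothField_extendField a
  have h : (fun y ↦ D (extendField w) y (extendField (c • u) y)) =
      c • (fun y ↦ D (extendField w) y (extendField u y)) := by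
    ext1 y
    simp [extendField_smul]
  simp only [curvature_eq hD, h, connection_const_smul c (hD hs hs), map_smul,
    smul_apply, smul_sub]

/-- The endomorphism `u ↦ R(u,v)w`. -/
def curvatureMap (hD : PreservesSmooth D) (v w : TangentSpace (𝓡 n) x) :
    TangentSpace (𝓡 n) x →ₗ[ℝ] TangentSpace (𝓡 n) x where
  toFun u := curvature D x u v w
  map_add' u u' := curvature_add_left hD u u' v w
  map_smul' c u := curvature_smul_left hD c u v w

theorem ricci_eq_trace (hD : PreservesSmooth D) (v w : TangentSpace (𝓡 n) x) :
    ricci D x v w = LinearMap.trace ℝ _ (curvatureMap hD v w) :=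
  endTrace_linearMap (curvatureMap hD v w)

theorem ricci_neg_left (hD : PreservesSmooth D) (v w : TangentSpace (𝓡 n) x) :
    ricci D x (-v) w = -ricci D x v w := by
  simp only [ricci_eq_trace hD, ← map_neg]
  congr 1
  ext1 u
  change curvature D x u (-v) w = -curvature D x u v w
  rw [curvature_swap hD, ← neg_one_smul ℝ v, curvature_smul_left hD, curvature_swap hD u]
  simp

/-- The first Bianchi identity for a torsion-free connection. -/
theorem curvature_bianchi (hD : PreservesSmooth D) (hT : D.torsion = 0)
    (u v w : TangentSpace (𝓡 n) x) :
    curvature D x u v w + curvature D x v w u + curvature D x w u v = 0 := by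
  have hs {a : TangentSpace (𝓡 n) x} := isSmoothField_extendField a
  -- Zero torsion and zero bracket give $\nabla_ba=\nabla_ab$ on a neighbourhood, so the equality
  -- survives a further derivative and the six terms cancel in pairs.
  have key (a b : TangentSpace (𝓡 n) x) :
      D (fun y ↦ D (extendField a) y (extendField b y)) x =
        D (fun y ↦ D (extendField b) y (extendField a y)) x := by
    refine connection_congr (hD hs hs) ?_
    filter_upwards [mlieBracket_extendField a b] with y hy
    have h := D.torsion_apply ((isSmoothField_extendField a).mdifferentiableAt y)
      ((isSmoothField_extendField b).mdifferentiableAt y)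
    rw [hT, hy, sub_zero] at h
    exact (sub_eq_zero.1 h.symm).symm
  simp only [curvature_eq hD]
  rw [key w v, key u w, key v u]
  abel

end Connection

end

/-! ### Linear algebra of Riemannian and Kähler curvature tensors. -/

section


section Algebra

variable {V : Type*} [AddCommGroup V] [Module ℝ V] [FiniteDimensional ℝ V]

/-- Mutually adjoint endomorphisms have the same trace. -/
theorem trace_eq_of_adjoint {g : LinearMap.BilinForm ℝ V} (hg : g.Nondegenerate)
    {f f' : V →ₗ[ℝ] V} (h : ∀ x y, g (f x) y = g x (f' y)) :
    LinearMap.trace ℝ V f = LinearMap.trace ℝ V f' := by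
  -- The isomorphism $V\cong V^*$ given by `g` conjugates `f` into the transpose of `f'`.
  have h1 : Module.Dual.transpose (R := ℝ) f' =
      (g.toDual hg).conj f := by
    ext φ y
    obtain ⟨x, rfl⟩ := (g.toDual hg).surjective φ
    simp only [LinearEquiv.conj_apply, LinearMap.comp_apply, LinearEquiv.coe_coe,
      LinearEquiv.symm_apply_apply, LinearMap.BilinForm.toDual_def, h]
    exact LinearMap.BilinForm.toDual_def hg
  rw [← LinearMap.trace_transpose' f', h1, LinearMap.trace_conj']

theorem trace_eq_zero_of_skew {g : LinearMap.BilinForm ℝ V} (hg : g.Nondegenerate)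
    {f : V →ₗ[ℝ] V} (h : ∀ x y, g (f x) y = -g x (f y)) : LinearMap.trace ℝ V f = 0 := by
  have := trace_eq_of_adjoint hg (f := f) (f' := -f) (by simpa using h)
  rw [map_neg] at this
  linarith

variable {g : LinearMap.BilinForm ℝ V} {R : V → V → V → V}

omit [FiniteDimensional ℝ V] in
/-- The pair symmetry of an algebraic curvature tensor. -/
theorem algCurvature_pair_symm (hsymm : ∀ x y, g x y = g y x)
    (hswap : ∀ u v w, R u v w = -R v u w)
    (hbianchi : ∀ u v w, R u v w + R v w u + R w u v = 0)
    (hskew : ∀ u v w z, g (R u v w) z = -g w (R u v z)) (u v w z : V) :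
    g (R u v w) z = g (R w z u) v := by
  have b (u v w z : V) : g (R u v w) z + g (R v w u) z + g (R w u v) z = 0 := by
    rw [← LinearMap.add_apply, ← LinearMap.add_apply, ← map_add, ← map_add, hbianchi]
    simp
  have s (u v w z : V) : g (R u v w) z = -g (R v u w) z := by
    rw [hswap u v w]; simp
  have k (u v w z : V) : g (R u v w) z = -g (R u v z) w := by
    rw [hskew, hsymm w]
  -- The classical octahedron argument: the four Bianchi identities on `u, v, w, z` are combined,
  -- and the two skew symmetries cancel all but the wanted pair.
  linarith [b u v w z, b v w z u, b w z u v, b z u v w, s u v w z, s u v z w, s w z u v, s w z v u,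
    k u v w z, k w z u v, k v w u z, k w u v z, k w z v u, k z v w u, k z u w v, k u w z v,
    k u v z w, k v z u w, s v w u z, s v w z u, s w u v z, s w u z v, s z v w u, s z v u w,
    s z u w v, s z u v w, k v z w u, k u z w v, k v w z u, k u w v z]

/-- The Ricci tensor of an algebraic curvature tensor is symmetric. -/
theorem algRicci_symm (hg : g.Nondegenerate) (hsymm : ∀ x y, g x y = g y x)
    (hswap : ∀ u v w, R u v w = -R v u w)
    (hbianchi : ∀ u v w, R u v w + R v w u + R w u v = 0)
    (hskew : ∀ u v w z, g (R u v w) z = -g w (R u v z))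
    {r : V → V → V →ₗ[ℝ] V} (hr : ∀ u v w, r v w u = R u v w) (v w : V) :
    LinearMap.trace ℝ V (r v w) = LinearMap.trace ℝ V (r w v) := by
  -- Pair symmetry makes $u\mapsto R(u,v)w$ and $u\mapsto R(u,w)v$ mutually adjoint.
  refine trace_eq_of_adjoint hg fun x y ↦ ?_
  rw [hr, hr, algCurvature_pair_symm hsymm hswap hbianchi hskew, hskew, hswap w y v, map_neg,
    neg_neg, hsymm]

/-- The Ricci tensor of a Kähler curvature tensor is invariant under the complex structure. -/
theorem algRicci_map_map (hg : g.Nondegenerate) (hsymm : ∀ x y, g x y = g y x)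
    (hswap : ∀ u v w, R u v w = -R v u w)
    (hbianchi : ∀ u v w, R u v w + R v w u + R w u v = 0)
    (hskew : ∀ u v w z, g (R u v w) z = -g w (R u v z))
    {r : V → V → V →ₗ[ℝ] V} (hr : ∀ u v w, r v w u = R u v w)
    {A : V →ₗ[ℝ] V} (hA : ∀ x, A (A x) = -x) (hgA : ∀ x y, g (A x) (A y) = g x y)
    (hRA : ∀ u v w, R u v (A w) = A (R u v w)) (v w : V) :
    LinearMap.trace ℝ V (r (A v) (A w)) = LinearMap.trace ℝ V (r v w) := by
  -- Pair symmetry moves the two `A`s to the last slots, where they commute with `R` and are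
  -- absorbed by the metric.
  have hRAA (u v w : V) : R (A u) (A v) w = R u v w := by
    refine sub_eq_zero.1 (hg.1 _ fun z ↦ ?_)
    rw [map_sub, LinearMap.sub_apply, sub_eq_zero,
      algCurvature_pair_symm hsymm hswap hbianchi hskew, hRA, hgA,
      ← algCurvature_pair_symm hsymm hswap hbianchi hskew]
  have hneg (u v w : V) : R u (-v) w = -R u v w := by
    rw [hswap, ← hr, map_neg, hr, hswap v, neg_neg]
  -- $R(u,Av)Aw=A\,R(Au,A^2v)w=-A\,R(Au,v)w$; cyclicity of the trace then brings the two `A`s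
  -- together.
  have h1 : r (A v) (A w) = -(A ∘ₗ (r v w ∘ₗ A)) := by
    ext u
    simp only [hr, LinearMap.neg_apply, LinearMap.comp_apply]
    rw [← hRAA u (A v), hA, hRA, hneg, map_neg]
  rw [h1, map_neg, LinearMap.trace_comp_comm', LinearMap.comp_assoc]
  have h2 : A ∘ₗ A = -LinearMap.id := by
    ext x
    simp [hA]
  rw [h2]
  simp

end Algebra

end

/-! ### Symmetries of the Levi-Civita curvature and of its Ricci tensor. -/

section


variable {n : ℕ} {M : Type*} [TopologicalSpace M] [ChartedSpace (EuclideanSpace ℝ (Fin n)) M]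
  [IsManifold (𝓡 n) ∞ M]

theorem isSmoothField_map {A : Π x : M, TangentSpace (𝓡 n) x →L[ℝ] TangentSpace (𝓡 n) x}
    (hA : ContMDiff (𝓡 n)
      ((𝓡 n).prod 𝓘(ℝ, EuclideanSpace ℝ (Fin n) →L[ℝ] EuclideanSpace ℝ (Fin n))) ∞
      (fun x ↦ TotalSpace.mk' (EuclideanSpace ℝ (Fin n) →L[ℝ] EuclideanSpace ℝ (Fin n))
        (E := fun x : M ↦ TangentSpace (𝓡 n) x →L[ℝ] TangentSpace (𝓡 n) x) x (A x)))
    {X : Π x : M, TangentSpace (𝓡 n) x} (hX : IsSmoothField X) :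
    IsSmoothField fun y ↦ A y (X y) :=
  ContMDiff.clm_bundle_apply hA hX

theorem preservesSmooth_of_contMDiff {D : LinearConnection n M}
    (hD : D.ContMDiffCovariantDerivative ∞) : PreservesSmooth D := by
  intro Y Z hY hZ
  have h := hD.contMDiff.contMDiff (σ := Z) (by simpa using ContMDiff.contMDiffOn hZ)
  exact isSmoothField_map (contMDiffOn_univ.1 h) hY

variable [RiemannianBundle (fun x : M ↦ TangentSpace (𝓡 n) x)]

/-- The metric at `x` as a bilinear form. -/
def metricForm (x : M) : LinearMap.BilinForm ℝ (TangentSpace (𝓡 n) x) :=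
  LinearMap.mk₂ ℝ (fun u v ↦ inner ℝ u v) inner_add_left
    (fun c u v ↦ real_inner_smul_left u v c) inner_add_right
    (fun c u v ↦ real_inner_smul_right u v c)

omit [IsManifold (𝓡 n) ∞ M] in
theorem metricForm_symm {x : M} (u v : TangentSpace (𝓡 n) x) :
    metricForm x u v = metricForm x v u := (real_inner_comm u v).symm

omit [IsManifold (𝓡 n) ∞ M] in
theorem metricForm_nondegenerate (x : M) : (metricForm (n := n) x).Nondegenerate := by
  refine ⟨fun u hu ↦ inner_self_eq_zero.1 (hu u), fun u hu ↦ inner_self_eq_zero.1 (hu u)⟩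

variable [IsContMDiffRiemannianBundle (𝓡 n) ∞ (EuclideanSpace ℝ (Fin n))
    (fun x : M ↦ TangentSpace (𝓡 n) x)]

theorem contMDiff_inner {X Y : Π x : M, TangentSpace (𝓡 n) x} (hX : IsSmoothField X)
    (hY : IsSmoothField Y) :
    ContMDiff (𝓡 n) 𝓘(ℝ, ℝ) ∞ fun y ↦ (inner ℝ (X y) (Y y) : ℝ) :=
  ContMDiff.inner_bundle hX hY

variable {D : LinearConnection n M} {x : M}

theorem mvfderiv_inner (hD : IsLeviCivita D) {S T : Π x : M, TangentSpace (𝓡 n) x}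
    (hS : IsSmoothField S) (hT : IsSmoothField T) (u : TangentSpace (𝓡 n) x) :
    mvfderiv (𝓡 n) (fun y ↦ (inner ℝ (S y) (T y) : ℝ)) x u =
      inner ℝ (D S x u) (T x) + inner ℝ (S x) (D T x u) := by
  have h := hD.metric.mvfderiv_inner_eq (FiberBundle.extend (EuclideanSpace ℝ (Fin n)) u)
    (hS.mdifferentiableAt x) (hT.mdifferentiableAt x)
  simpa using h

variable [T2Space M]

/-- The Ricci identity for the metric: the curvature operator, applied to arbitrary smooth fields,
is skew-adjoint. -/
theorem inner_curvature_skew (hD : IsLeviCivita D) {S T : Π x : M, TangentSpace (𝓡 n) x}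
    (hS : IsSmoothField S) (hT : IsSmoothField T) (u v : TangentSpace (𝓡 n) x) :
    inner ℝ (D (fun y ↦ D S y (extendField v y)) x u - D (fun y ↦ D S y (extendField u y)) x v)
        (T x)
      + inner ℝ (S x)
        (D (fun y ↦ D T y (extendField v y)) x u - D (fun y ↦ D T y (extendField u y)) x v) = 0 := by
  have hP := preservesSmooth_of_contMDiff hD.smooth
  have hs {a : TangentSpace (𝓡 n) x} := isSmoothField_extendField a
  have hsm := contMDiff_inner hS hT
  have key (a b : TangentSpace (𝓡 n) x) :
      mvfderiv (𝓡 n) (fun y ↦ mvfderiv (𝓡 n) (fun y ↦ (inner ℝ (S y) (T y) : ℝ)) y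
        (extendField a y)) x b =
      inner ℝ (D (fun y ↦ D S y (extendField a y)) x b) (T x) +
        inner ℝ (D S x a) (D T x b) + (inner ℝ (D S x b) (D T x a) +
        inner ℝ (S x) (D (fun y ↦ D T y (extendField a y)) x b)) := by
    have h1 : (fun y ↦ mvfderiv (𝓡 n) (fun y ↦ (inner ℝ (S y) (T y) : ℝ)) y (extendField a y)) =
        (fun y ↦ inner ℝ (D S y (extendField a y)) (T y)) +
          fun y ↦ inner ℝ (S y) (D T y (extendField a y)) := by
      ext1 y
      exact mvfderiv_inner hD hS hT _
    rw [h1, mvfderiv_add ((contMDiff_inner (hP hs hS) hT).mdifferentiableAt (by simp))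
      ((contMDiff_inner hS (hP hs hT)).mdifferentiableAt (by simp)), add_apply,
      mvfderiv_inner hD (hP hs hS) hT, mvfderiv_inner hD hS (hP hs hT)]
    simp
  -- The mixed products in `key` are symmetric in `a, b`, so they drop out of the commutator of
  -- second derivatives of $g(S,T)$, which is zero.
  have h := mvfderiv_mvfderiv_comm hsm u v
  rw [key, key] at h
  rw [inner_sub_left, inner_sub_right]
  linarith

theorem curvature_skew (hD : IsLeviCivita D) (u v w z : TangentSpace (𝓡 n) x) :
    metricForm x (curvature D x u v w) z = -metricForm x w (curvature D x u v z) := by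
  have h := inner_curvature_skew hD (isSmoothField_extendField w) (isSmoothField_extendField z) u v
  rw [← curvature_eq (preservesSmooth_of_contMDiff hD.smooth),
    ← curvature_eq (preservesSmooth_of_contMDiff hD.smooth), extendField_self,
    extendField_self] at h
  exact eq_neg_of_add_eq_zero_left h

/-- The curvature operator is tensorial in the differentiated field. -/
theorem curvature_apply_field (hD : IsLeviCivita D) {S : Π x : M, TangentSpace (𝓡 n) x}
    (hS : IsSmoothField S) (u v : TangentSpace (𝓡 n) x) :
    D (fun y ↦ D S y (extendField v y)) x u - D (fun y ↦ D S y (extendField u y)) x v =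
      curvature D x u v (S x) := by
  -- After skew-adjointness moves the derivatives onto the extension of `z`, the field `S` enters
  -- only through `S x`.
  refine ext_inner_right ℝ fun z ↦ ?_
  have h := inner_curvature_skew hD hS (isSmoothField_extendField z) u v
  rw [← curvature_eq (preservesSmooth_of_contMDiff hD.smooth), extendField_self] at h
  exact (eq_neg_of_add_eq_zero_left h).trans (curvature_skew hD u v (S x) z).symm

section Kahler

variable {A : Π x : M, TangentSpace (𝓡 n) x →L[ℝ] TangentSpace (𝓡 n) x}

/-- The field $A$ applied to an extension of `w` need not be a coordinate field, hence the use of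
`curvature_apply_field`; then $\nabla A=0$ pulls `A` through both derivatives. -/
theorem curvature_map_right (hD : IsLeviCivita D) (hA : IsKahler D A)
    (u v w : TangentSpace (𝓡 n) x) :
    curvature D x u v (A x w) = A x (curvature D x u v w) := by
  have hP := preservesSmooth_of_contMDiff hD.smooth
  have hs {a : TangentSpace (𝓡 n) x} := isSmoothField_extendField a
  have h := curvature_apply_field hD (isSmoothField_map hA.smooth (hs (a := w))) u v
  have key (a b : TangentSpace (𝓡 n) x) :
      D (fun y ↦ D (fun y ↦ A y (extendField w y)) y (extendField a y)) x b =
        A x (D (fun y ↦ D (extendField w) y (extendField a y)) x b) := by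
    have h1 : (fun y ↦ D (fun y ↦ A y (extendField w y)) y (extendField a y)) =
        fun y ↦ A y (D (extendField w) y (extendField a y)) := by
      ext1 y
      exact hA.parallel _ y (hs.mdifferentiableAt y) _
    rw [h1]
    exact hA.parallel _ x ((hP hs hs).mdifferentiableAt x) b
  rw [key, key, extendField_self] at h
  rw [← h, curvature_eq hP, map_sub]

theorem ricci_symm (hD : IsLeviCivita D) (v w : TangentSpace (𝓡 n) x) :
    ricci D x v w = ricci D x w v := by
  have hP := preservesSmooth_of_contMDiff hD.smooth
  rw [ricci_eq_trace hP, ricci_eq_trace hP]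
  exact algRicci_symm (metricForm_nondegenerate x) metricForm_symm (curvature_swap hP)
    (curvature_bianchi hP hD.torsion_eq_zero) (curvature_skew hD) (fun _ _ _ ↦ rfl) v w

theorem ricci_map_map (hD : IsLeviCivita D) (hA : IsKahler D A) (v w : TangentSpace (𝓡 n) x) :
    ricci D x (A x v) (A x w) = ricci D x v w := by
  have hP := preservesSmooth_of_contMDiff hD.smooth
  rw [ricci_eq_trace hP, ricci_eq_trace hP]
  exact algRicci_map_map (A := (A x : TangentSpace (𝓡 n) x →ₗ[ℝ] TangentSpace (𝓡 n) x))
    (metricForm_nondegenerate x) metricForm_symm (curvature_swap hP)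
    (curvature_bianchi hP hD.torsion_eq_zero) (curvature_skew hD) (fun _ _ _ ↦ rfl)
    (hA.sq x) (hA.inner_map x) (curvature_map_right hD hA) v w

theorem ricci_map_left (hD : IsLeviCivita D) (hA : IsKahler D A) (v w : TangentSpace (𝓡 n) x) :
    ricci D x (A x v) w = -ricci D x v (A x w) := by
  rw [← ricci_map_map hD hA, hA.sq, ricci_neg_left (preservesSmooth_of_contMDiff hD.smooth)]

-- $A$ is skew for the metric, because it is orthogonal with $A^2=-I$.
omit [IsContMDiffRiemannianBundle (𝓡 n) ∞ (EuclideanSpace ℝ (Fin n))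
    (fun x : M ↦ TangentSpace (𝓡 n) x)] [T2Space M] in
theorem trace_complexStructure (hA : IsAlmostHermitian A) (x : M) :
    LinearMap.trace ℝ _ (A x : TangentSpace (𝓡 n) x →ₗ[ℝ] TangentSpace (𝓡 n) x) = 0 := by
  refine trace_eq_zero_of_skew (metricForm_nondegenerate x) fun u v ↦ ?_
  have h := hA.inner_map x u (A x v)
  rw [hA.sq, inner_neg_right] at h
  exact neg_eq_iff_eq_neg.1 h

end Kahler

end

/-! ### Curvature of the quarter-symmetric connection and of its dual. -/

section


variable {n : ℕ} {M : Type*} [TopologicalSpace M] [ChartedSpace (EuclideanSpace ℝ (Fin n)) M]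
  [IsManifold (𝓡 n) ∞ M]

theorem IsSmoothOneForm.contMDiff_apply {p : Π x : M, TangentSpace (𝓡 n) x →L[ℝ] ℝ}
    (hp : IsSmoothOneForm p) {X : Π x : M, TangentSpace (𝓡 n) x} (hX : IsSmoothField X) :
    ContMDiff (𝓡 n) 𝓘(ℝ, ℝ) ∞ fun y ↦ p y (X y) := by
  intro x
  have h : ContMDiffAt (𝓡 n) (𝓘(ℝ, EuclideanSpace ℝ (Fin n)).prod 𝓘(ℝ, ℝ)) ∞
      (fun y ↦ TotalSpace.mk' ℝ (E := Bundle.Trivial M ℝ) y (p y (X y))) x :=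
    ContMDiffAt.clm_bundle_apply (E₂ := Bundle.Trivial M ℝ) (hp x) (hX x)
  rw [contMDiffAt_totalSpace] at h
  exact h.2

variable {D : LinearConnection n M}
  {A : Π x : M, TangentSpace (𝓡 n) x →L[ℝ] TangentSpace (𝓡 n) x}
  {p : Π x : M, TangentSpace (𝓡 n) x →L[ℝ] ℝ} {x : M}

theorem quarterSymmetric_apply (Y : Π x : M, TangentSpace (𝓡 n) x) (u : TangentSpace (𝓡 n) x) :
    quarterSymmetric D A p Y x u = D Y x u - p x u • A x (Y x) := rfl

variable [T2Space M]

/-- $\nabla_YX+[X,Y]=\nabla_XY$ when the torsion is zero, so dualizing only exchanges the arguments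
in $\pi(X)AY$. -/
theorem dualConnection_quarterSymmetric_apply (hT : D.torsion = 0)
    {Y : Π x : M, TangentSpace (𝓡 n) x} (hY : IsSmoothField Y) (u : TangentSpace (𝓡 n) x) :
    dualConnection (quarterSymmetric D A p) Y x u = D Y x u - p x (Y x) • A x u := by
  have hu := (isSmoothField_extendField u).mdifferentiableAt x
  have h := dualConnection_apply (quarterSymmetric D A p) hu (hY.mdifferentiableAt x)
  have h' := D.torsion_apply hu (hY.mdifferentiableAt x)
  rw [extendField_self] at h h'
  rw [h, quarterSymmetric_apply, extendField_self]
  rw [hT] at h'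
  have h'' : D Y x u - D (extendField u) x (Y x) =
      VectorField.mlieBracket (𝓡 n) (extendField u) Y x := (sub_eq_zero.1 h'.symm)
  rw [← h'']
  abel

/-- The differential of the 1-form `p`, as a linear function of its first argument. -/
def oneFormDeriv (hp : IsSmoothOneForm p) (v : TangentSpace (𝓡 n) x) :
    TangentSpace (𝓡 n) x →ₗ[ℝ] ℝ where
  -- The term $p([u,v])$ of the exterior derivative is absent because the two extensions commute
  -- near `x`.
  toFun u := mvfderiv (𝓡 n) (fun y ↦ p y (extendField v y)) x u
    - mvfderiv (𝓡 n) (fun y ↦ p y (extendField u y)) x v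
  map_add' u u' := by
    have h : (fun y ↦ p y (extendField (u + u') y)) =
        (fun y ↦ p y (extendField u y)) + fun y ↦ p y (extendField u' y) := by
      ext1 y
      simp [extendField_add]
    rw [h, mvfderiv_add
      ((hp.contMDiff_apply (isSmoothField_extendField u)).mdifferentiableAt (by simp))
      ((hp.contMDiff_apply (isSmoothField_extendField u')).mdifferentiableAt (by simp))]
    simp only [map_add, add_apply]
    ring
  map_smul' c u := by
    have h : (fun y ↦ p y (extendField (c • u) y)) =
        (fun _ ↦ c) * fun y ↦ p y (extendField u y) := by
      ext1 y
      simp [extendField_smul]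
    rw [h, mvfderiv_mul mdifferentiableAt_const
      ((hp.contMDiff_apply (isSmoothField_extendField u)).mdifferentiableAt (by simp)),
      mvfderiv_const]
    simp
    ring

/-- The tensor `(∇_u p)(w) + p(w) p(Au)`, as a linear function of `u`. -/
def oneFormCovDeriv (D : LinearConnection n M)
    (A : Π x : M, TangentSpace (𝓡 n) x →L[ℝ] TangentSpace (𝓡 n) x)
    (p : Π x : M, TangentSpace (𝓡 n) x →L[ℝ] ℝ) (w : TangentSpace (𝓡 n) x) :
    TangentSpace (𝓡 n) x →ₗ[ℝ] ℝ :=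
  (mvfderiv (𝓡 n) (fun y ↦ p y (extendField w y)) x - p x ∘L D (extendField w) x +
    p x w • (p x ∘L A x) : TangentSpace (𝓡 n) x →L[ℝ] ℝ)

variable [RiemannianBundle (fun x : M ↦ TangentSpace (𝓡 n) x)]
  [IsContMDiffRiemannianBundle (𝓡 n) ∞ (EuclideanSpace ℝ (Fin n))
    (fun x : M ↦ TangentSpace (𝓡 n) x)]

omit [T2Space M] in
theorem preservesSmooth_quarterSymmetric (hD : IsLeviCivita D) (hA : IsKahler D A)
    (hp : IsSmoothOneForm p) : PreservesSmooth (quarterSymmetric D A p) := fun _ _ hY hZ ↦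
  (preservesSmooth_of_contMDiff hD.smooth hY hZ).sub
    ((isSmoothField_map hA.smooth hZ).smul (hp.contMDiff_apply hY))

theorem preservesSmooth_dualConnection (hD : IsLeviCivita D) (hA : IsKahler D A)
    (hp : IsSmoothOneForm p) : PreservesSmooth (dualConnection (quarterSymmetric D A p)) := by
  intro Y Z hY hZ
  simp only [dualConnection_quarterSymmetric_apply hD.torsion_eq_zero hZ]
  exact (preservesSmooth_of_contMDiff hD.smooth hY hZ).sub
    ((isSmoothField_map hA.smooth hY).smul (hp.contMDiff_apply hZ))

/-- The terms of first order in $\nabla w$ and the term quadratic in $\pi$ are symmetric in `u, v`;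
only the derivatives of $\pi$ survive antisymmetrization. -/
theorem curvature_quarterSymmetric (hD : IsLeviCivita D) (hA : IsKahler D A)
    (hp : IsSmoothOneForm p) (u v w : TangentSpace (𝓡 n) x) :
    curvature (quarterSymmetric D A p) x u v w =
      curvature D x u v w - oneFormDeriv hp v u • A x w := by
  have hP := preservesSmooth_of_contMDiff hD.smooth
  have hs {a : TangentSpace (𝓡 n) x} := isSmoothField_extendField a
  have hAs := isSmoothField_map hA.smooth (hs (a := w))
  have key (a b : TangentSpace (𝓡 n) x) :
      quarterSymmetric D A p
        (fun y ↦ quarterSymmetric D A p (extendField w) y (extendField a y)) x b =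
      D (fun y ↦ D (extendField w) y (extendField a y)) x b
        - p x a • A x (D (extendField w) x b)
        - mvfderiv (𝓡 n) (fun y ↦ p y (extendField a y)) x b • A x w
        - p x b • A x (D (extendField w) x a) - (p x b * p x a) • w := by
    have h1 : (fun y ↦ quarterSymmetric D A p (extendField w) y (extendField a y)) =
        (fun y ↦ D (extendField w) y (extendField a y)) -
          (fun y ↦ p y (extendField a y)) • fun y ↦ A y (extendField w y) := rfl
    have hf := hp.contMDiff_apply (hs (a := a))
    rw [quarterSymmetric_apply, h1, connection_sub (hP hs hs) (hAs.smul hf), sub_apply,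
      connection_smul hf hAs, hA.parallel _ x (hs.mdifferentiableAt x), quarterSymmetric_apply]
    simp only [extendField_self, map_sub, map_smul, hA.sq]
    module
  rw [curvature_eq (preservesSmooth_quarterSymmetric hD hA hp), curvature_eq hP, key, key]
  simp only [oneFormDeriv, LinearMap.coe_mk, AddHom.coe_mk]
  module

theorem curvature_dualConnection (hD : IsLeviCivita D) (hA : IsKahler D A)
    (hp : IsSmoothOneForm p) (u v w : TangentSpace (𝓡 n) x) :
    curvature (dualConnection (quarterSymmetric D A p)) x u v w =
      curvature D x u v w - oneFormCovDeriv D A p w u • A x v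
        + oneFormCovDeriv D A p w v • A x u := by
  have hP := preservesSmooth_of_contMDiff hD.smooth
  have hP2 := preservesSmooth_dualConnection hD hA hp
  have hs {a : TangentSpace (𝓡 n) x} := isSmoothField_extendField a
  have hf := hp.contMDiff_apply (hs (a := w))
  have hdual (y : M) (Z : Π x : M, TangentSpace (𝓡 n) x) (hZ : IsSmoothField Z)
      (a : TangentSpace (𝓡 n) y) := dualConnection_quarterSymmetric_apply (A := A) (p := p)
        hD.torsion_eq_zero hZ a
  have key (a b : TangentSpace (𝓡 n) x) :
      dualConnection (quarterSymmetric D A p)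
        (fun y ↦ dualConnection (quarterSymmetric D A p) (extendField w) y (extendField a y)) x b =
      D (fun y ↦ D (extendField w) y (extendField a y)) x b
        - p x w • A x (D (extendField a) x b)
        - mvfderiv (𝓡 n) (fun y ↦ p y (extendField w y)) x b • A x a
        - p x (D (extendField w) x a) • A x b + (p x w * p x (A x a)) • A x b := by
    have hAs := isSmoothField_map hA.smooth (hs (a := a))
    have h1 : (fun y ↦ dualConnection (quarterSymmetric D A p) (extendField w) y
          (extendField a y)) =
        (fun y ↦ D (extendField w) y (extendField a y)) -
          (fun y ↦ p y (extendField w y)) • fun y ↦ A y (extendField a y) := by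
      ext1 y
      exact hdual y _ hs _
    rw [hdual x _ (hP2 hs hs), h1, connection_sub (hP hs hs) (hAs.smul hf), sub_apply,
      connection_smul hf hAs, hA.parallel _ x (hs.mdifferentiableAt x), hdual x _ hs]
    simp only [extendField_self, map_sub, map_smul, smul_eq_mul]
    module
  -- This cancels the terms that differentiate the extensions of `u` and `v`.
  have hcomm : D (extendField v) x u = D (extendField u) x v := by
    have h := D.torsion_apply ((isSmoothField_extendField u).mdifferentiableAt x)
      ((isSmoothField_extendField v).mdifferentiableAt x)
    rw [hD.torsion_eq_zero, (mlieBracket_extendField u v).self_of_nhds, extendField_self,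
      extendField_self, sub_zero] at h
    exact sub_eq_zero.1 h.symm
  rw [curvature_eq hP2, curvature_eq hP, key, key, hcomm]
  simp only [oneFormCovDeriv, ContinuousLinearMap.coe_coe, add_apply, sub_apply, smul_apply,
    ContinuousLinearMap.comp_apply, smul_eq_mul]
  module

theorem ricci_quarterSymmetric (hD : IsLeviCivita D) (hA : IsKahler D A)
    (hp : IsSmoothOneForm p) (v w : TangentSpace (𝓡 n) x) :
    ricci (quarterSymmetric D A p) x v w = ricci D x v w - oneFormDeriv hp v (A x w) := by
  have hP := preservesSmooth_of_contMDiff hD.smooth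
  have hP1 := preservesSmooth_quarterSymmetric hD hA hp
  have h : curvatureMap hP1 v w =
      curvatureMap hP v w - (oneFormDeriv hp v).smulRight (A x w) := by
    ext1 u
    exact curvature_quarterSymmetric hD hA hp u v w
  rw [ricci_eq_trace hP1, ricci_eq_trace hP, h, map_sub, LinearMap.trace_smulRight]

/-- The correction $\theta_w(u)Av$ is of rank one in `u`, with trace $\theta_w(Av)$; the other
correction is a multiple of $\mathrm{tr}\,A=0$. -/
theorem ricci_dualConnection (hD : IsLeviCivita D) (hA : IsKahler D A)
    (hp : IsSmoothOneForm p) (v w : TangentSpace (𝓡 n) x) :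
    ricci (dualConnection (quarterSymmetric D A p)) x v w =
      ricci D x v w - oneFormCovDeriv D A p w (A x v) := by
  have hP := preservesSmooth_of_contMDiff hD.smooth
  have hP2 := preservesSmooth_dualConnection hD hA hp
  have h : curvatureMap hP2 v w =
      curvatureMap hP v w - (oneFormCovDeriv D A p w).smulRight (A x v) +
        oneFormCovDeriv D A p w v • (A x : TangentSpace (𝓡 n) x →ₗ[ℝ] TangentSpace (𝓡 n) x) := by
    ext1 u
    exact curvature_dualConnection hD hA hp u v w
  rw [ricci_eq_trace hP2, ricci_eq_trace hP, h, map_add, map_sub, map_smul,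
    LinearMap.trace_smulRight, trace_complexStructure hA.toIsAlmostHermitian, smul_zero, add_zero]

theorem tensorH1_eq (hD : IsLeviCivita D) (hA : IsKahler D A)
    (hp : IsSmoothOneForm p) (u v w : TangentSpace (𝓡 n) x) :
    tensorH1 (quarterSymmetric D A p) A x u v w =
      curvature D x u v w + ricci D x v (A x u) • A x w := by
  rw [tensorH1, curvature_quarterSymmetric hD hA hp, ricci_quarterSymmetric hD hA hp, hA.sq,
    map_neg]
  module

theorem tensorH2_eq (hD : IsLeviCivita D) (hA : IsKahler D A)
    (hp : IsSmoothOneForm p) (u v w : TangentSpace (𝓡 n) x) :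
    tensorH2 (quarterSymmetric D A p) A x u v w =
      curvature D x u v w + ricci D x (A x u) w • A x v - ricci D x (A x v) w • A x u := by
  rw [tensorH2, curvature_dualConnection hD hA hp, ricci_dualConnection hD hA hp,
    ricci_dualConnection hD hA hp, hA.sq, hA.sq, map_neg, map_neg]
  module

theorem two_tensorH1_add_tensorH2 (hn : 4 ≤ n) (hD : IsLeviCivita D) (hA : IsKahler D A)
    (hp : IsSmoothOneForm p) (u v w : TangentSpace (𝓡 n) x) :
    (2 : ℝ) • tensorH1 (quarterSymmetric D A p) A x u v w
        + tensorH2 (quarterSymmetric D A p) A x u v w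
      = ((n : ℝ) + 2) • holProjective D A x u v w - ((n : ℝ) - 1) • weylProjective D x u v w := by
  have h1 : (n : ℝ) - 1 ≠ 0 := by
    have : (4 : ℝ) ≤ n := by exact_mod_cast hn
    linarith
  have h2 : (n : ℝ) + 2 ≠ 0 := by positivity
  rw [tensorH1_eq hD hA hp, tensorH2_eq hD hA hp, holProjective, weylProjective,
    ricci_map_left hD hA, ricci_map_left hD hA, ricci_symm hD v, ricci_map_left hD hA]
  -- All Ricci terms now have the forms of `holProjective`, using $Ric(v,Au)=Ric(Au,v)=-Ric(u,Av)$.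
  match_scalars <;> field_simp <;> ring

end

end KahlerQS

end

theorem mainTheorem7 {n : ℕ} (hn : 4 ≤ n)
    {M : Type*} [TopologicalSpace M] [T2Space M] [ChartedSpace (EuclideanSpace ℝ (Fin n)) M]
    [IsManifold (𝓡 n) ∞ M]
    [RiemannianBundle (fun x : M ↦ TangentSpace (𝓡 n) x)]
    [IsContMDiffRiemannianBundle (𝓡 n) ∞ (EuclideanSpace ℝ (Fin n))
      (fun x : M ↦ TangentSpace (𝓡 n) x)]
    (D : KahlerQS.LinearConnection n M) (hD : KahlerQS.IsLeviCivita D)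
    (A : Π x : M, TangentSpace (𝓡 n) x →L[ℝ] TangentSpace (𝓡 n) x)
    (hA : KahlerQS.IsKahler D A)
    (p : Π x : M, TangentSpace (𝓡 n) x →L[ℝ] ℝ) (hp : KahlerQS.IsSmoothOneForm p) :
    (∀ (x : M) (u v w : TangentSpace (𝓡 n) x),
      (2 : ℝ) • KahlerQS.tensorH1 (KahlerQS.quarterSymmetric D A p) A x u v w
          + KahlerQS.tensorH2 (KahlerQS.quarterSymmetric D A p) A x u v w
        = ((n : ℝ) + 2) • KahlerQS.holProjective D A x u v w
          - ((n : ℝ) - 1) • KahlerQS.weylProjective D x u v w) ∧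
    ((∀ (x : M) (u v w : TangentSpace (𝓡 n) x),
        KahlerQS.tensorH1 (KahlerQS.quarterSymmetric D A p) A x u v w = 0) →
      (∀ (x : M) (u v w : TangentSpace (𝓡 n) x),
        KahlerQS.tensorH2 (KahlerQS.quarterSymmetric D A p) A x u v w = 0) →
      ∀ (x : M) (u v w : TangentSpace (𝓡 n) x),
        KahlerQS.holProjective D A x u v w
          = (((n : ℝ) - 1) / ((n : ℝ) + 2)) • KahlerQS.weylProjective D x u v w) := by

  have key := fun (x : M) (u v w : TangentSpace (𝓡 n) x) ↦
    KahlerQS.two_tensorH1_add_tensorH2 hn hD hA hp u v w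
  refine ⟨key, fun h1 h2 x u v w ↦ ?_⟩
  have h := key x u v w
  rw [h1, h2, smul_zero, add_zero] at h
  have hn2 : (n : ℝ) + 2 ≠ 0 := by positivity
  rw [div_eq_inv_mul, mul_smul, ← sub_eq_zero.1 h.symm, smul_smul, inv_mul_cancel₀ hn2, one_smul]
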